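/- Let $n\ge 1$ and let $A$ be an $n\times n$ complex matrix of rank $n-1$ that is a partial isometry, i.e. $\|Ax\|=\|x\|$ for all $x\in\mathbb C^n$ orthogonal to $\ker A$. Write $\operatorname{Re}X=(X+X^*)/2$ and let $W(A)=\{\langle Ax,x\rangle : x\in\mathbb C^n,\ \|x\|=1\}$ be the numerical range of $A$. Call $A$ unitarily irreducible if the only subspaces of $\mathbb C^n$ invariant under both $A$ and $A^*$ are $\{0\}$ and $\mathbb C^n$. Call $A$ generic if for every $\theta\in(-\pi,\pi]$ the eigenvalues $\lambda_1(\theta)\ge\dots\ge\lambda_n(\theta)$ of $\operatorname{Re}(e^{-i\theta}A)$, counted with multiplicity, satisfy $\lambda_1(\theta)>\dots>\lambda_n(\theta)$. Then the following hold. (NF) If $A$ is unitarily irreducible, then $A$ is generic, and the boundary $\partial W(A)$ contains no line segment with distinct endpoints. (Circ) If $A$ is nilpotent, then $W(A)$ is a closed circular disk centered at the origin, of positive radius if $n\ge 2$ (for $n=1$ it is the single point $\{0\}$). Moreover: (a) If $A$ is unitarily irreducible, then $A$ belongs to the class $S_n$: $\|Ax\|\le\|x\|$ for all $x\in\mathbb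 C^n$, all eigenvalues of $A$ lie in the open unit disk, and $I-A^*A$ has rank one. (b) $A$ is nilpotent if and only if it is unitarily similar to the $n\times n$ Jordan block with eigenvalue $0$ (ones on the first superdiagonal, zeros elsewhere), i.e. $A=UJU^*$ with $U$ unitary and $J$ that block. -/

import Mathlib

namespace PartialIsometry

/-- `A` acting as an operator on `ℂⁿ` with its standard scalar product. -/
noncomputable abbrev op {n : ℕ} (A : Matrix (Fin n) (Fin n) ℂ) :
    EuclideanSpace ℂ (Fin n) →L[ℂ] EuclideanSpace ℂ (Fin n) :=
  Matrix.toEuclideanCLM (n := Fin n) (𝕜 := ℂ) A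

/-- `A` preserves the norms of the vectors orthogonal to its kernel. -/
def IsPartialIsometry {n : ℕ} (A : Matrix (Fin n) (Fin n) ℂ) : Prop :=
  ∀ x ∈ (LinearMap.ker (op A).toLinearMap)ᗮ, ‖op A x‖ = ‖x‖

/-- The numerical range: all `⟨Ax, x⟩` with `‖x‖ = 1`. Mathlib's `inner` is conjugate-linear in its
first argument, hence the order of the arguments. -/
def numericalRange {n : ℕ} (A : Matrix (Fin n) (Fin n) ℂ) : Set ℂ :=
  {z | ∃ x : EuclideanSpace ℂ (Fin n), ‖x‖ = 1 ∧ inner ℂ x (op A x) = z}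

/-- The only subspaces invariant under both `A` and `A*` are the trivial ones. -/
def UnitarilyIrreducible {n : ℕ} (A : Matrix (Fin n) (Fin n) ℂ) : Prop :=
  ∀ L : Submodule ℂ (EuclideanSpace ℂ (Fin n)),
    (∀ x ∈ L, op A x ∈ L) → (∀ x ∈ L, op A.conjTranspose x ∈ L) → L = ⊥ ∨ L = ⊤

/-- `Re X = (X + X*) / 2`. -/
noncomputable def rePart {n : ℕ} (X : Matrix (Fin n) (Fin n) ℂ) : Matrix (Fin n) (Fin n) ℂ :=
  (2⁻¹ : ℂ) • (X + X.conjTranspose)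

theorem rePart_isHermitian {n : ℕ} (X : Matrix (Fin n) (Fin n) ℂ) : (rePart X).IsHermitian := by
  simp [rePart, Matrix.IsHermitian, Matrix.conjTranspose_smul, add_comm]

/-- `e^{-iθ} A`. -/
noncomputable def rotate {n : ℕ} (A : Matrix (Fin n) (Fin n) ℂ) (θ : ℝ) :
    Matrix (Fin n) (Fin n) ℂ :=
  Complex.exp (-(Complex.I * θ)) • A

/-- For every `θ ∈ (-π, π]` the eigenvalues `λ₁(θ) ≥ ⋯ ≥ λₙ(θ)` of `Re (e^{-iθ} A)`, listed with
multiplicity in nonincreasing order (this is `eigenvalues₀`), are strictly decreasing. -/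
def IsGeneric {n : ℕ} (A : Matrix (Fin n) (Fin n) ℂ) : Prop :=
  ∀ θ ∈ Set.Ioc (-Real.pi) Real.pi, StrictAnti (rePart_isHermitian (rotate A θ)).eigenvalues₀

/-- The class `Sₙ`: contractions whose eigenvalues all lie in the open unit disk and for which
`I - A*A` has rank one. -/
def IsClassS {n : ℕ} (A : Matrix (Fin n) (Fin n) ℂ) : Prop :=
  (∀ x, ‖op A x‖ ≤ ‖x‖) ∧ spectrum ℂ A ⊆ Metric.ball 0 1 ∧ (1 - A.conjTranspose * A).rank = 1

def UnitarilySimilar {n : ℕ} (A B : Matrix (Fin n) (Fin n) ℂ) : Prop :=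
  ∃ U ∈ Matrix.unitaryGroup (Fin n) ℂ, A = U * B * U.conjTranspose

/-- The `n`-by-`n` Jordan block with eigenvalue `0`. -/
def jordanBlock (n : ℕ) : Matrix (Fin n) (Fin n) ℂ :=
  Matrix.of fun i j => if (i : ℕ) + 1 = (j : ℕ) then 1 else 0

/-- No line segment with distinct endpoints is contained in `S`. -/
def ContainsNoSegment (S : Set ℂ) : Prop :=
  ∀ x y : ℂ, x ≠ y → ¬ segment ℝ x y ⊆ S

/-- If `A` is unitarily irreducible, then it is generic, and the boundary of its numerical range
contains no line segments. -/
def NF {n : ℕ} (A : Matrix (Fin n) (Fin n) ℂ) : Prop :=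
  UnitarilyIrreducible A → IsGeneric A ∧ ContainsNoSegment (frontier (numericalRange A))

/-- If `A` is nilpotent, then `W(A)` is a closed circular disk centered at the origin. The disk may
degenerate to a point only for `n = 1`. -/
def Circ {n : ℕ} (A : Matrix (Fin n) (Fin n) ℂ) : Prop :=
  IsNilpotent A →
    ∃ r : ℝ, 0 ≤ r ∧ (2 ≤ n → 0 < r) ∧ numericalRange A = Metric.closedBall 0 r

end PartialIsometry

/-!
Let `T` be the operator of `A`. It is a contraction, and since it is isometric on `(ker T)ᗮ`, the
operator `1 - T*T` is the projection onto the line `ker T`.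

*Irreducible matrices.* An eigenvector of the contraction `T` for a unimodular eigenvalue is also an
eigenvector of `T*`; it would span a reducing line, so irreducibility excludes it. This places all
eigenvalues in the open disk. Suppose now that, for some unimodular `c`, the operator `cT + c̄T*` had
an eigenspace of dimension two, for the eigenvalue `2λ`. Some `z ≠ 0` in it is orthogonal to the line
`ker T`, so `T*Tz = z`. Applying `S = c̄T*` to the eigenvector equation gives
`S²z - 2λSz + z = 0`; as `|λ| ≤ 1`, both roots of the quadratic are unimodular, and one of them is an
eigenvalue of `S`, which yields a unimodular eigenvalue of `T`
(`eq_zero_of_realPart_eigenvector`). Hence all `Re (e^{-iθ}A)` have simple eigenvalues.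

*Segments.* The numerical range is compact and, by the Toeplitz–Hausdorff theorem
(`convex_setOf_inner_self_apply`), convex. A segment in its boundary lies on the supporting line at
its midpoint, and the points of the numerical range on a supporting line come from eigenvectors for
the largest eigenvalue of some `Re (e^{-iθ}A)`. This eigenvalue being simple, there is only one such
point (`containsNoSegment_frontier_of_simple`).

*Nilpotent matrices.* Here `Tⁿ = 0`, and as the kernel of `T` is a line, the range of `T` is
`ker Tⁿ⁻¹`. For a unit vector `u` orthogonal to it, the orbit `u, Tu, …, Tⁿ⁻¹u` is orthonormal
(`exists_orthonormal_orbit`), and in the reversed orbit `T` is the Jordan block. Diagonal unitary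
matrices rotate the Jordan block, so its numerical range is rotation invariant, and a nonempty
compact convex set with this property is a disk about `0`. The radius vanishes only for `A = 0`,
that is, for `n = 1`.
-/

open scoped InnerProductSpace
open ContinuousLinearMap (adjoint)

namespace PartialIsometry

/-! ### Contractions and partial isometries -/

section Operators

variable {E : Type*} [NormedAddCommGroup E] [InnerProductSpace ℂ E] [FiniteDimensional ℂ E]

theorem norm_apply_le_of_norm_eq_on_ker_orthogonal {T : E →L[ℂ] E}
    (hT : ∀ x ∈ (LinearMap.ker T.toLinearMap)ᗮ, ‖T x‖ = ‖x‖) (x : E) : ‖T x‖ ≤ ‖x‖ := by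
  obtain ⟨y, hy, z, hz, rfl⟩ :=
    (LinearMap.ker T.toLinearMap).exists_add_mem_mem_orthogonal x
  have hy' : T y = 0 := hy
  have h := norm_add_sq_eq_norm_sq_add_norm_sq_of_inner_eq_zero y z
    ((Submodule.mem_orthogonal _ _).1 hz y hy)
  rw [map_add, hy', zero_add, hT z hz]
  nlinarith [norm_nonneg (y + z), norm_nonneg z, mul_self_nonneg ‖y‖]

theorem norm_adjoint_apply_le {T : E →L[ℂ] E} (hT : ∀ x, ‖T x‖ ≤ ‖x‖) (x : E) :
    ‖adjoint T x‖ ≤ ‖x‖ := by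
  have h1 : ‖T‖ ≤ 1 := T.opNorm_le_bound zero_le_one fun x => by simpa using hT x
  have h2 : ‖adjoint T‖ ≤ 1 := by simpa using h1
  simpa using (adjoint T).le_of_opNorm_le h2 x

/-- A contraction that preserves the norm of `x` is undone by its adjoint at `x`: expanding the
square shows `‖T*Tx - x‖² ≤ 0`. -/
theorem adjoint_apply_apply_of_norm_eq {T : E →L[ℂ] E} (hT : ∀ x, ‖T x‖ ≤ ‖x‖) {x : E}
    (hx : ‖T x‖ = ‖x‖) : adjoint T (T x) = x := by
  have h1 := norm_sub_sq (𝕜 := ℂ) (adjoint T (T x)) x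
  rw [ContinuousLinearMap.adjoint_inner_left, inner_self_eq_norm_sq] at h1
  have h2 := norm_adjoint_apply_le hT (T x)
  have h3 : ‖adjoint T (T x) - x‖ ^ 2 ≤ 0 := by
    rw [h1, hx]
    rw [hx] at h2
    nlinarith [norm_nonneg (adjoint T (T x))]
  exact sub_eq_zero.1 (norm_eq_zero.1 (pow_eq_zero_iff two_ne_zero |>.1
    (le_antisymm h3 (sq_nonneg _))))

theorem adjoint_apply_of_apply_eq_smul {T : E →L[ℂ] E} (hT : ∀ x, ‖T x‖ ≤ ‖x‖) {μ : ℂ}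
    (hμ : ‖μ‖ = 1) {x : E} (hx : T x = μ • x) : adjoint T x = starRingEnd ℂ μ • x := by
  have h := adjoint_apply_apply_of_norm_eq hT (x := x) (by rw [hx, norm_smul, hμ, one_mul])
  rw [hx, map_smul] at h
  have hμ' : starRingEnd ℂ μ * μ = 1 := by rw [Complex.conj_mul', hμ]; norm_num
  calc adjoint T x = (starRingEnd ℂ μ * μ) • adjoint T x := by rw [hμ', one_smul]
    _ = starRingEnd ℂ μ • x := by rw [mul_smul, h]

/-- If `z` is an eigenvector of `cT + c̄T*` whose norm is preserved by `T`, then `S = c̄T*`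
satisfies `S²z - 2λSz + z = 0`. Both roots of this quadratic have modulus one, so `T` has a
unimodular eigenvalue. -/
theorem eq_zero_of_realPart_eigenvector {T : E →L[ℂ] E} (hT : ∀ x, ‖T x‖ ≤ ‖x‖)
    (hev : ∀ (μ : ℂ) (x : E), ‖μ‖ = 1 → T x = μ • x → x = 0) {c : ℂ} (hc : ‖c‖ = 1) {l : ℝ}
    {z : E} (hz : c • T z + starRingEnd ℂ c • adjoint T z = (2 * l : ℂ) • z)
    (hnorm : ‖T z‖ = ‖z‖) : z = 0 := by
  by_contra hz0
  have hc' : starRingEnd ℂ c * c = 1 := by rw [Complex.conj_mul', hc]; norm_num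
  set S : E →L[ℂ] E := starRingEnd ℂ c • adjoint T with hS
  have hSapp : ∀ x, S x = starRingEnd ℂ c • adjoint T x := fun x => rfl
  have hadj := adjoint_apply_apply_of_norm_eq hT hnorm
  have hquad : S (S z) = (2 * l : ℂ) • S z - z := by
    have hz' : c • T z + S z = (2 * l : ℂ) • z := hz
    have h := congrArg S hz'
    rw [map_add, map_smul, map_smul, hSapp (T z), hadj, smul_smul, mul_comm c, hc', one_smul] at h
    rw [← h, add_sub_cancel_left]
  -- a unimodular eigenvalue of `S` yields one of `T`
  have hSev : ∀ (μ : ℂ) (x : E), ‖μ‖ = 1 → S x = μ • x → x = 0 := by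
    intro μ x hμ hx
    have h1 : adjoint T x = (c * μ) • x := by
      rw [mul_smul, ← hx, hSapp, smul_smul, mul_comm c, hc', one_smul]
    have h2 := adjoint_apply_of_apply_eq_smul (norm_adjoint_apply_le hT)
      (by rw [norm_mul, hc, hμ, one_mul]) h1
    rw [ContinuousLinearMap.adjoint_adjoint] at h2
    exact hev _ x (by rw [RCLike.norm_conj, norm_mul, hc, hμ, one_mul]) h2
  have hl : l ^ 2 ≤ 1 := by
    have h1 : ‖(2 * l : ℂ) • z‖ ≤ 2 * ‖z‖ := by
      rw [← hz]
      refine (norm_add_le _ _).trans ?_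
      rw [norm_smul, norm_smul, RCLike.norm_conj, hc, one_mul, one_mul]
      linarith [hT z, norm_adjoint_apply_le hT z]
    rw [norm_smul, norm_mul, Complex.norm_real, Complex.norm_ofNat] at h1
    have h2 : |l| ≤ 1 := by
      have := le_of_mul_le_mul_right h1 (norm_pos_iff.2 hz0)
      rw [Real.norm_eq_abs] at this
      linarith
    exact (sq_le_one_iff_abs_le_one l).2 h2
  have hs := Real.sq_sqrt (sub_nonneg.2 hl)
  set s := Real.sqrt (1 - l ^ 2)
  have hmod : ∀ t : ℝ, t ^ 2 = 1 - l ^ 2 → ‖(l + t * Complex.I : ℂ)‖ = 1 := by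
    intro t ht
    rw [Complex.norm_add_mul_I, ht, add_sub_cancel, Real.sqrt_one]
  have hsC : (s : ℂ) ^ 2 = 1 - (l : ℂ) ^ 2 := by exact_mod_cast hs
  have hw : S z - (l + (-s : ℝ) * Complex.I : ℂ) • z = 0 := by
    refine hSev (l + s * Complex.I) _ (hmod s hs) ?_
    rw [map_sub, map_smul, hquad]
    have hprod : (l + s * Complex.I : ℂ) * (l + (-s : ℝ) * Complex.I) = 1 := by
      push_cast
      linear_combination hsC - (s : ℂ) ^ 2 * Complex.I_sq
    rw [smul_sub, smul_smul, hprod]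
    push_cast
    module
  exact hz0 (hSev _ z (hmod (-s) (by rw [neg_sq, hs])) (sub_eq_zero.1 hw))

/-- Two independent vectors have a nonzero combination orthogonal to a line. -/
theorem exists_mem_span_pair_orthogonal {K : Submodule ℂ E} (hK : Module.finrank ℂ K = 1)
    {x y : E} (hxy : LinearIndependent ℂ ![x, y]) :
    ∃ a b : ℂ, a • x + b • y ≠ 0 ∧ a • x + b • y ∈ Kᗮ := by
  obtain ⟨v, -, hv⟩ := finrank_eq_one_iff'.1 hK
  have hmem : ∀ z : E, ⟪(v : E), z⟫_ℂ = 0 → z ∈ Kᗮ := by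
    intro z hz
    rw [Submodule.mem_orthogonal]
    intro u hu
    obtain ⟨c, hc⟩ := hv ⟨u, hu⟩
    have : u = c • (v : E) := (congrArg Subtype.val hc).symm
    rw [this, inner_smul_left, hz, mul_zero]
  rw [LinearIndependent.pair_iff] at hxy
  by_cases h : ⟪(v : E), x⟫_ℂ = 0
  · refine ⟨1, 0, fun h0 => ?_, hmem _ (by simp [h])⟩
    exact one_ne_zero (hxy 1 0 h0).1
  · refine ⟨⟪(v : E), y⟫_ℂ, -⟪(v : E), x⟫_ℂ, fun h0 => h (neg_eq_zero.1 (hxy _ _ h0).2),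
      hmem _ ?_⟩
    rw [inner_add_right, inner_smul_right, inner_smul_right]
    ring

/-- The eigenspaces of `cT + c̄T*` are at most one-dimensional. -/
theorem not_linearIndependent_of_realPart_eigenvectors {T : E →L[ℂ] E}
    (hT : ∀ x ∈ (LinearMap.ker T.toLinearMap)ᗮ, ‖T x‖ = ‖x‖)
    (hker : Module.finrank ℂ (LinearMap.ker T.toLinearMap) = 1)
    (hev : ∀ (μ : ℂ) (x : E), ‖μ‖ = 1 → T x = μ • x → x = 0) {c : ℂ} (hc : ‖c‖ = 1) {l : ℝ}
    {x y : E} (hx : c • T x + starRingEnd ℂ c • adjoint T x = (2 * l : ℂ) • x)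
    (hy : c • T y + starRingEnd ℂ c • adjoint T y = (2 * l : ℂ) • y) :
    ¬ LinearIndependent ℂ ![x, y] := by
  intro hxy
  obtain ⟨a, b, h0, hz⟩ := exists_mem_span_pair_orthogonal hker hxy
  refine h0 (eq_zero_of_realPart_eigenvector
    (norm_apply_le_of_norm_eq_on_ker_orthogonal hT) hev hc (l := l) ?_ (hT _ hz))
  calc c • T (a • x + b • y) + starRingEnd ℂ c • adjoint T (a • x + b • y)
      = a • (c • T x + starRingEnd ℂ c • adjoint T x)
        + b • (c • T y + starRingEnd ℂ c • adjoint T y) := by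
        simp only [map_add, map_smul]
        module
    _ = (2 * l : ℂ) • (a • x + b • y) := by
        rw [hx, hy]
        module

theorem range_one_sub_adjoint_mul_self {T : E →L[ℂ] E}
    (hT : ∀ x ∈ (LinearMap.ker T.toLinearMap)ᗮ, ‖T x‖ = ‖x‖) :
    LinearMap.range (1 - adjoint T * T).toLinearMap = LinearMap.ker T.toLinearMap := by
  have happ : ∀ x, (1 - adjoint T * T) x = x - adjoint T (T x) := fun x => rfl
  apply le_antisymm
  · rintro _ ⟨x, rfl⟩
    obtain ⟨y, hy, z, hz, rfl⟩ :=
      (LinearMap.ker T.toLinearMap).exists_add_mem_mem_orthogonal x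
    have hy' : T y = 0 := hy
    have h := adjoint_apply_apply_of_norm_eq
      (norm_apply_le_of_norm_eq_on_ker_orthogonal hT) (hT z hz)
    change (1 - adjoint T * T) (y + z) ∈ _
    rw [happ, map_add, hy', zero_add, h, add_sub_cancel_right]
    exact hy
  · intro y hy
    have hy' : T y = 0 := hy
    exact ⟨y, by change (1 - adjoint T * T) y = y; rw [happ, hy', map_zero, sub_zero]⟩

end Operators

/-! ### The numerical range of an operator -/

section NumericalRange

variable {E : Type*} [NormedAddCommGroup E] [InnerProductSpace ℂ E]

theorem exists_inner_self_apply_eq_of_mem_Icc {T : E →L[ℂ] E} {x y : E}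
    (hx : ⟪x, T x⟫_ℂ = 0) (hy : ⟪y, T y⟫_ℂ = 1) (hx1 : ‖x‖ = 1) (hy1 : ‖y‖ = 1) {s : ℝ}
    (hs : s ∈ Set.Icc (0 : ℝ) 1) : ∃ z : E, ‖z‖ = 1 ∧ ⟪z, T z⟫_ℂ = s := by
  -- choose the phase of `x` so that the cross terms have a real sum
  obtain ⟨c, hc, hre⟩ : ∃ c : ℂ, ‖c‖ = 1 ∧
      (starRingEnd ℂ c * ⟪x, T y⟫_ℂ + c * ⟪y, T x⟫_ℂ).im = 0 := by
    set δ : ℂ := ⟪y, T x⟫_ℂ - starRingEnd ℂ ⟪x, T y⟫_ℂ with hδ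
    have him : ∀ c : ℂ, (starRingEnd ℂ c * ⟪x, T y⟫_ℂ + c * ⟪y, T x⟫_ℂ).im = (c * δ).im := by
      intro c
      rw [hδ]
      simp only [Complex.add_im, Complex.mul_im, Complex.conj_re, Complex.conj_im, Complex.sub_re,
        Complex.sub_im]
      ring
    by_cases h0 : δ = 0
    · exact ⟨1, norm_one, by rw [him, h0]; simp⟩
    · have hn : (‖δ‖ : ℂ) ≠ 0 := by exact_mod_cast norm_ne_zero_iff.2 h0
      refine ⟨starRingEnd ℂ δ / ‖δ‖, ?_, ?_⟩
      · rw [norm_div, RCLike.norm_conj, Complex.norm_real, norm_norm,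
          div_self (norm_ne_zero_iff.2 h0)]
      · rw [him, div_mul_eq_mul_div, Complex.conj_mul', sq, mul_div_assoc, div_self hn, mul_one,
          Complex.ofReal_im]
  set β : ℝ := (starRingEnd ℂ c * ⟪x, T y⟫_ℂ + c * ⟪y, T x⟫_ℂ).re
  have hβ : starRingEnd ℂ c * ⟪x, T y⟫_ℂ + c * ⟪y, T x⟫_ℂ = (β : ℂ) :=
    Complex.ext rfl (by rw [hre, Complex.ofReal_im])
  set z : ℝ → E := fun t => ((1 - t : ℝ) : ℂ) • c • x + (t : ℂ) • y with hz
  have hzT : ∀ t, ⟪z t, T (z t)⟫_ℂ = ((t ^ 2 + t * (1 - t) * β : ℝ) : ℂ) := by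
    intro t
    simp only [hz, map_add, map_smul, inner_add_left, inner_add_right, inner_smul_left,
      inner_smul_right, hx, hy, Complex.conj_ofReal]
    push_cast
    linear_combination (t : ℂ) * (1 - t) * hβ
  have hz0 : ∀ t, z t ≠ 0 := by
    intro t h
    have h1 : (t : ℂ) • y = -(((1 - t : ℝ) : ℂ) • c • x) := by
      rw [eq_neg_iff_add_eq_zero, add_comm]
      exact h
    have h2 : (t : ℂ) ^ 2 = 0 := by
      have h3 := congrArg (fun w => ⟪w, T w⟫_ℂ) h1
      simp only [map_neg, map_smul, inner_neg_left, inner_neg_right, inner_smul_left,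
        inner_smul_right, hx, hy, Complex.conj_ofReal, mul_zero, neg_zero, mul_one] at h3
      rw [sq, h3]
    have ht : t = 0 := by simpa using h2
    have h4 : ‖z t‖ = 1 := by simp [hz, ht, norm_smul, hc, hx1]
    rw [h, norm_zero] at h4
    exact zero_ne_one h4
  have hcont : Continuous z := by
    simp only [hz]
    fun_prop
  have hg : ContinuousOn (fun t : ℝ => (t ^ 2 + t * (1 - t) * β) / ‖z t‖ ^ 2) (Set.Icc 0 1) := by
    refine ContinuousOn.div (by fun_prop) (by fun_prop) fun t _ => ?_
    exact pow_ne_zero 2 (norm_ne_zero_iff.2 (hz0 t))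
  obtain ⟨t, -, ht⟩ := intermediate_value_Icc zero_le_one hg
    (show s ∈ Set.Icc _ _ by simpa [hz, hy1] using hs)
  have hn := norm_ne_zero_iff.2 (hz0 t)
  refine ⟨((‖z t‖⁻¹ : ℝ) : ℂ) • z t, ?_, ?_⟩
  · rw [norm_smul, Complex.norm_real, norm_inv, norm_norm, inv_mul_cancel₀ hn]
  · rw [map_smul, inner_smul_left, inner_smul_right, hzT, Complex.conj_ofReal, ← ht]
    push_cast
    field_simp

/-- The **Toeplitz–Hausdorff theorem**. An affine change of the operator moves the given endpoints
to `0` and `1`, which reduces it to the intermediate value theorem. -/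
theorem convex_setOf_inner_self_apply (T : E →L[ℂ] E) :
    Convex ℝ {z : ℂ | ∃ x : E, ‖x‖ = 1 ∧ ⟪x, T x⟫_ℂ = z} := by
  rw [convex_iff_segment_subset]
  rintro a ⟨x, hx1, hx⟩ b ⟨y, hy1, hy⟩
  by_cases hab : a = b
  · rw [hab, segment_same, Set.singleton_subset_iff]
    exact ⟨y, hy1, hy⟩
  have hd : b - a ≠ 0 := sub_ne_zero.2 (Ne.symm hab)
  rw [segment_eq_image']
  rintro _ ⟨s, hs, rfl⟩
  set S : E →L[ℂ] E := (b - a)⁻¹ • (T - a • ContinuousLinearMap.id ℂ E)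
  have hST : ∀ w : E, ‖w‖ = 1 → ⟪w, S w⟫_ℂ = (b - a)⁻¹ * (⟪w, T w⟫_ℂ - a) := by
    intro w hw
    have hww : ⟪w, w⟫_ℂ = 1 := by rw [inner_self_eq_norm_sq_to_K, hw]; norm_num
    change ⟪w, (b - a)⁻¹ • (T w - a • w)⟫_ℂ = _
    rw [inner_smul_right, inner_sub_right, inner_smul_right, hww, mul_one]
  obtain ⟨z, hz1, hz⟩ := exists_inner_self_apply_eq_of_mem_Icc (T := S) (x := x) (y := y)
    (by rw [hST x hx1, hx, sub_self, mul_zero]) (by rw [hST y hy1, hy, inv_mul_cancel₀ hd])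
    hx1 hy1 hs
  refine ⟨z, hz1, ?_⟩
  rw [hST z hz1, inv_mul_eq_iff_eq_mul₀ hd] at hz
  change _ = a + s • (b - a)
  rw [Complex.real_smul]
  linear_combination hz

theorem isCompact_setOf_inner_self_apply [FiniteDimensional ℂ E] (T : E →L[ℂ] E) :
    IsCompact {z : ℂ | ∃ x : E, ‖x‖ = 1 ∧ ⟪x, T x⟫_ℂ = z} := by
  have := FiniteDimensional.proper_rclike ℂ E
  have h : {z : ℂ | ∃ x : E, ‖x‖ = 1 ∧ ⟪x, T x⟫_ℂ = z}
      = (fun x => ⟪x, T x⟫_ℂ) '' Metric.sphere (0 : E) 1 := by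
    ext z
    simp
  rw [h]
  exact (isCompact_sphere 0 1).image (by fun_prop)

theorem exists_norm_eq_one_forall_re_mul_le {S : Set ℂ} (hS : Convex ℝ S) {m : ℂ} (hm : m ∈ S)
    (hm' : m ∉ interior S) : ∃ c : ℂ, ‖c‖ = 1 ∧ ∀ w ∈ S, (c * w).re ≤ (c * m).re := by
  obtain ⟨c, hc, h⟩ : ∃ c : ℂ, c ≠ 0 ∧ ∀ w ∈ S, (c * w).re ≤ (c * m).re := by
    by_cases hint : (interior S).Nonempty
    · obtain ⟨f, hf, h⟩ := RCLike.geometric_hahn_banach_of_nonempty_interior_point (𝕜 := ℂ)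
        hS hm' hint
      have hfz : ∀ z, f z = f 1 * z := fun z => by
        rw [mul_comm, ← smul_eq_mul, ← map_smul, smul_eq_mul, mul_one]
      refine ⟨f 1, fun h0 => hf (ContinuousLinearMap.ext fun z => by rw [hfz, h0]; simp),
        fun w hw => ?_⟩
      rw [← hfz, ← hfz]
      exact h w hw
    · -- a convex set without interior points lies in a line
      rw [hS.interior_nonempty_iff_affineSpan_eq_top,
        ← AffineSubspace.direction_eq_top_iff_of_nonempty
          ((affineSpan_nonempty ℝ).2 ⟨m, hm⟩), direction_affineSpan] at hint
      obtain ⟨φ, hφ, hle⟩ := Submodule.exists_le_ker_of_lt_top _ (lt_top_iff_ne_top.2 hint)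
      have hφz : ∀ z : ℂ, φ z = (((φ 1 : ℝ) - (φ Complex.I : ℝ) * Complex.I : ℂ) * z).re := by
        intro z
        have hz : z = z.re • (1 : ℂ) + z.im • Complex.I := by
          simp
        conv_lhs => rw [hz, map_add, map_smul, map_smul]
        simp
        ring
      refine ⟨(φ 1 : ℝ) - (φ Complex.I : ℝ) * Complex.I, fun h0 => hφ ?_, fun w hw => ?_⟩
      · refine LinearMap.ext fun z => ?_
        rw [hφz, h0, zero_mul]
        rfl
      · rw [← hφz, ← hφz]
        have := hle (vsub_mem_vectorSpan ℝ hw hm)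
        rw [LinearMap.mem_ker, vsub_eq_sub, map_sub, sub_eq_zero] at this
        exact this.le
  have hn := norm_pos_iff.2 hc
  refine ⟨((‖c‖⁻¹ : ℝ) : ℂ) * c, ?_, fun w hw => ?_⟩
  · rw [norm_mul, Complex.norm_real, norm_inv, norm_norm, inv_mul_cancel₀ hn.ne']
  · rw [mul_assoc, mul_assoc, Complex.re_ofReal_mul, Complex.re_ofReal_mul]
    exact mul_le_mul_of_nonneg_left (h w hw) (inv_nonneg.2 hn.le)

theorem eq_closedBall_of_convex_of_rotation {K : Set ℂ} (hconv : Convex ℝ K) (hcomp : IsCompact K)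
    (hne : K.Nonempty) (hrot : ∀ c : ℂ, ‖c‖ = 1 → ∀ z ∈ K, c * z ∈ K) :
    ∃ r : ℝ, 0 ≤ r ∧ K = Metric.closedBall 0 r := by
  obtain ⟨w, hw, hmax⟩ := hcomp.exists_isMaxOn hne continuous_norm.continuousOn
  refine ⟨‖w‖, norm_nonneg w, Set.Subset.antisymm (fun z hz => ?_) fun z hz => ?_⟩
  · rw [mem_closedBall_zero_iff]
    exact hmax hz
  rw [mem_closedBall_zero_iff] at hz
  have hneg : -w ∈ K := by simpa using hrot (-1) (by simp) w hw
  have h0 : (0 : ℂ) ∈ K := by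
    have := hconv hw hneg (a := 2⁻¹) (b := 2⁻¹) (by norm_num) (by norm_num) (by norm_num)
    simpa using this
  by_cases hz0 : z = 0
  · rwa [hz0]
  have hzpos := norm_pos_iff.2 hz0
  have hwpos := hzpos.trans_le hz
  have hw0 := norm_pos_iff.1 hwpos
  have hmem : (‖z‖ / ‖w‖) • w ∈ K :=
    (hconv.starConvex h0).smul_mem hw (by positivity) ((div_le_one hwpos).2 hz)
  have hne' : (‖z‖ / ‖w‖) • w ≠ 0 := smul_ne_zero (by positivity) hw0
  have := hrot (z / ((‖z‖ / ‖w‖) • w)) ?_ _ hmem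
  · rwa [div_mul_cancel₀ _ hne'] at this
  · rw [norm_div, norm_smul, norm_div, norm_norm, norm_norm, div_mul_cancel₀ _ hwpos.ne',
      div_self hzpos.ne']

/-- A unit vector at which `Re (c⟨Tx, x⟩)` is maximal is an eigenvector of `cT + c̄T*`. -/
theorem realPart_apply_eq_smul_of_isMax [FiniteDimensional ℂ E] {T : E →L[ℂ] E} {c : ℂ} {l : ℝ}
    (hmax : ∀ w : E, ‖w‖ = 1 → (c * ⟪w, T w⟫_ℂ).re ≤ l) {x : E} (hx1 : ‖x‖ = 1)
    (hx : (c * ⟪x, T x⟫_ℂ).re = l) :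
    c • T x + starRingEnd ℂ c • adjoint T x = (2 * l : ℂ) • x := by
  set H : E →L[ℂ] E := c • T + starRingEnd ℂ c • adjoint T with hH
  have hsa : IsSelfAdjoint H := by
    rw [IsSelfAdjoint, hH, star_add, star_smul, star_smul, ← ContinuousLinearMap.star_eq_adjoint,
      star_star, add_comm]
    simp
  have hre : ∀ w, H.reApplyInnerSelf w = 2 * (c * ⟪w, T w⟫_ℂ).re := by
    intro w
    have h1 : ⟪H w, w⟫_ℂ = starRingEnd ℂ (c * ⟪w, T w⟫_ℂ) + c * ⟪w, T w⟫_ℂ := by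
      change ⟪c • T w + starRingEnd ℂ c • adjoint T w, w⟫_ℂ = _
      rw [inner_add_left, inner_smul_left, inner_smul_left, ContinuousLinearMap.adjoint_inner_left,
        Complex.conj_conj, map_mul, inner_conj_symm]
    rw [ContinuousLinearMap.reApplyInnerSelf_apply, h1]
    change (_ + _ : ℂ).re = _
    rw [Complex.add_re, Complex.conj_re]
    ring
  have h := hsa.eq_smul_self_of_isLocalExtrOn (x₀ := x) <| Or.inr <| IsMaxOn.localize <|
    fun w hw => by
      rw [hx1, mem_sphere_zero_iff_norm] at hw
      change H.reApplyInnerSelf w ≤ H.reApplyInnerSelf x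
      rw [hre, hre, hx]
      linarith [hmax w hw]
  rw [ContinuousLinearMap.rayleighQuotient, hre, hx, hx1] at h
  simpa [hH] using h

/-- If all the operators `cT + c̄T*` with `|c| = 1` have simple eigenvalues, every supporting line
touches the numerical range in a single point. -/
theorem containsNoSegment_frontier_of_simple [FiniteDimensional ℂ E] {T : E →L[ℂ] E}
    (hsimple : ∀ (c : ℂ) (l : ℝ) (x y : E), ‖c‖ = 1 →
      c • T x + starRingEnd ℂ c • adjoint T x = (2 * l : ℂ) • x →
      c • T y + starRingEnd ℂ c • adjoint T y = (2 * l : ℂ) • y → ¬ LinearIndependent ℂ ![x, y]) :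
    ContainsNoSegment (frontier {z : ℂ | ∃ x : E, ‖x‖ = 1 ∧ ⟪x, T x⟫_ℂ = z}) := by
  intro p q hpq hseg
  have hconv := convex_setOf_inner_self_apply T
  have hclosed := (isCompact_setOf_inner_self_apply T).isClosed
  have hm := hseg (midpoint_mem_segment p q)
  obtain ⟨x, hx1, hx⟩ := hclosed.frontier_subset (hseg (left_mem_segment ℝ p q))
  obtain ⟨y, hy1, hy⟩ := hclosed.frontier_subset (hseg (right_mem_segment ℝ p q))
  obtain ⟨c, hc, hle⟩ := exists_norm_eq_one_forall_re_mul_le hconv (hclosed.frontier_subset hm)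
    hm.2
  have hp := hle p ⟨x, hx1, hx⟩
  have hq := hle q ⟨y, hy1, hy⟩
  have hmid : 2 * (c * midpoint ℝ p q).re = (c * p).re + (c * q).re := by
    rw [midpoint_eq_smul_add, mul_smul_comm, mul_add]
    simp
    ring
  have hmax : ∀ w : E, ‖w‖ = 1 → (c * ⟪w, T w⟫_ℂ).re ≤ (c * midpoint ℝ p q).re :=
    fun w hw => hle _ ⟨w, hw, rfl⟩
  have hxe := realPart_apply_eq_smul_of_isMax hmax hx1 (by rw [hx]; linarith)
  have hye := realPart_apply_eq_smul_of_isMax hmax hy1 (by rw [hy]; linarith)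
  have hx0 : x ≠ 0 := norm_ne_zero_iff.1 (by rw [hx1]; exact one_ne_zero)
  have hdep := hsimple c _ x y hc hxe hye
  rw [LinearIndependent.pair_iff' hx0] at hdep
  push Not at hdep
  obtain ⟨a, rfl⟩ := hdep
  have ha : ‖a‖ = 1 := by rwa [norm_smul, hx1, mul_one] at hy1
  apply hpq
  rw [← hx, ← hy, map_smul, inner_smul_left, inner_smul_right, ← mul_assoc, Complex.conj_mul', ha]
  norm_num

end NumericalRange

/-! ### Nilpotent partial isometries of corank one -/

section Nilpotent

variable {E : Type*} [NormedAddCommGroup E] [InnerProductSpace ℂ E] [FiniteDimensional ℂ E]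

theorem finrank_ker_pow_succ_le {K V : Type*} [Field K] [AddCommGroup V] [Module K V]
    [FiniteDimensional K V] (f : Module.End K V) (k : ℕ) :
    Module.finrank K (LinearMap.ker (f ^ (k + 1))) ≤
      Module.finrank K (LinearMap.ker (f ^ k)) + Module.finrank K (LinearMap.ker f) := by
  set g := f.domRestrict (LinearMap.ker (f ^ (k + 1)))
  rw [← g.finrank_range_add_finrank_ker]
  refine add_le_add (Submodule.finrank_mono ?_) ?_
  · rintro _ ⟨⟨x, hx⟩, rfl⟩
    rw [LinearMap.mem_ker, pow_succ] at hx
    exact hx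
  · rw [← Submodule.finrank_map_subtype_eq]
    refine Submodule.finrank_mono ?_
    rintro _ ⟨⟨x, hx⟩, hx', rfl⟩
    exact hx'

theorem finrank_ker_pow_le {K V : Type*} [Field K] [AddCommGroup V] [Module K V]
    [FiniteDimensional K V] (f : Module.End K V) (k : ℕ) :
    Module.finrank K (LinearMap.ker (f ^ k)) ≤ k * Module.finrank K (LinearMap.ker f) := by
  induction k with
  | zero => simp [Module.End.one_eq_id]
  | succ k ih => exact (finrank_ker_pow_succ_le f k).trans (by rw [add_mul, one_mul]; omega)

/-- A nilpotent endomorphism with one-dimensional kernel has maximal nilpotency index, so the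
kernel of its power one below that index is its range. -/
theorem range_eq_ker_pow_of_pow_succ_eq_zero {K V : Type*} [Field K] [AddCommGroup V] [Module K V]
    [FiniteDimensional K V] {f : Module.End K V} {m : ℕ} (hdim : Module.finrank K V = m + 1)
    (hker : Module.finrank K (LinearMap.ker f) = 1) (hf : f ^ (m + 1) = 0) :
    LinearMap.range f = LinearMap.ker (f ^ m) := by
  refine Submodule.eq_of_le_of_finrank_le ?_ ?_
  · rintro _ ⟨x, rfl⟩
    rw [LinearMap.mem_ker, ← Module.End.mul_apply, ← pow_succ, hf, LinearMap.zero_apply]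
  · have h1 := finrank_ker_pow_le f m
    have h2 := f.finrank_range_add_finrank_ker
    rw [hker] at h1 h2
    omega

/-- The orbit of a unit vector orthogonal to the range is orthonormal: inductively
`Tʲu ⟂ ker Tᵐ⁻ʲ`, since `T` is isometric on the orthogonal complement of its kernel and every vector
of `ker Tᵐ⁻ʲ⁻¹` has the form `Tz` with `z ∈ ker Tᵐ⁻ʲ`. -/
theorem exists_orthonormal_orbit {T : E →L[ℂ] E} {m : ℕ}
    (hT : ∀ x ∈ (LinearMap.ker T.toLinearMap)ᗮ, ‖T x‖ = ‖x‖)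
    (hker : Module.finrank ℂ (LinearMap.ker T.toLinearMap) = 1)
    (hdim : Module.finrank ℂ E = m + 1) (hnil : T ^ (m + 1) = 0) :
    ∃ u : E, Orthonormal ℂ fun j : Fin (m + 1) => (T ^ (j : ℕ)) u := by
  have hpow : ∀ (k : ℕ) (x : E), (T.toLinearMap ^ k) x = (T ^ k) x := by
    intro k x
    induction k generalizing x with
    | zero => rfl
    | succ k ih => rw [pow_succ, pow_succ, Module.End.mul_apply, ih]; rfl
  have hsucc : ∀ (k : ℕ) (x : E), (T ^ (k + 1)) x = T ((T ^ k) x) := by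
    intro k x
    rw [pow_succ']
    rfl
  have hsucc' : ∀ (k : ℕ) (x : E), (T ^ (k + 1)) x = (T ^ k) (T x) := by
    intro k x
    rw [pow_succ]
    rfl
  have hnil' : T.toLinearMap ^ (m + 1) = 0 := by
    ext x
    rw [hpow, hnil]
    rfl
  have hrange := range_eq_ker_pow_of_pow_succ_eq_zero hdim hker hnil'
  have hle : ∀ {j k : ℕ} {x : E}, j ≤ k → (T ^ j) x = 0 → (T ^ k) x = 0 := by
    intro j k x hjk hx
    obtain ⟨d, rfl⟩ := Nat.exists_eq_add_of_le' hjk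
    rw [pow_add]
    change (T ^ d) ((T ^ j) x) = 0
    rw [hx, map_zero]
  have hpre : ∀ y, (T ^ m) y = 0 → ∃ z, T z = y := by
    intro y hy
    have : y ∈ LinearMap.range T.toLinearMap := by rw [hrange, LinearMap.mem_ker, hpow, hy]
    exact this
  -- a unit vector orthogonal to `ker Tᵐ`
  obtain ⟨u, hu1, hu⟩ : ∃ u : E, ‖u‖ = 1 ∧ ∀ y, (T ^ m) y = 0 → ⟪y, u⟫_ℂ = 0 := by
    have hne : (LinearMap.ker (T.toLinearMap ^ m))ᗮ ≠ ⊥ := by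
      rw [Ne, Submodule.orthogonal_eq_bot_iff]
      intro htop
      have h1 := finrank_ker_pow_le T.toLinearMap m
      rw [hker, htop, finrank_top, hdim] at h1
      omega
    obtain ⟨w, hw, hw0⟩ := Submodule.exists_mem_ne_zero_of_ne_bot hne
    have hn := norm_ne_zero_iff.2 hw0
    refine ⟨((‖w‖⁻¹ : ℝ) : ℂ) • w, ?_, fun y hy => ?_⟩
    · rw [norm_smul, Complex.norm_real, norm_inv, norm_norm, inv_mul_cancel₀ hn]
    · rw [inner_smul_right, (Submodule.mem_orthogonal _ _).1 hw y
        (by rw [LinearMap.mem_ker, hpow, hy]), mul_zero]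
  have hperp : ∀ x : E, (∀ y, T y = 0 → ⟪y, x⟫_ℂ = 0) → ‖T x‖ = ‖x‖ ∧ adjoint T (T x) = x := by
    intro x hx
    have h1 := hT x ((Submodule.mem_orthogonal _ _).2 fun y hy => hx y hy)
    exact ⟨h1, adjoint_apply_apply_of_norm_eq
      (norm_apply_le_of_norm_eq_on_ker_orthogonal hT) h1⟩
  have hmain : ∀ j ≤ m, ‖(T ^ j) u‖ = 1 ∧ ∀ y, (T ^ (m - j)) y = 0 → ⟪y, (T ^ j) u⟫_ℂ = 0 := by
    intro j
    induction j with
    | zero => exact fun _ => ⟨hu1, hu⟩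
    | succ j ih =>
      intro hj
      obtain ⟨ih1, ih2⟩ := ih (by omega)
      obtain ⟨h1, h2⟩ := hperp ((T ^ j) u) fun y hy =>
        ih2 y (hle (j := 1) (by omega) (by rw [pow_one]; exact hy))
      refine ⟨by rw [hsucc, h1, ih1], fun y hy => ?_⟩
      obtain ⟨z, rfl⟩ := hpre y (hle (by omega) hy)
      rw [← hsucc', show m - (j + 1) + 1 = m - j by omega] at hy
      rw [hsucc, ← ContinuousLinearMap.adjoint_inner_right, h2]
      exact ih2 z hy
  refine ⟨u, fun j => (hmain j (by omega)).1, ?_⟩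
  -- for `i < j` the vector `Tʲu` lies in `ker Tᵐ⁻ⁱ`
  have hlt : ∀ i j : ℕ, i < j → j ≤ m → ⟪(T ^ j) u, (T ^ i) u⟫_ℂ = 0 := by
    intro i j hij hj
    refine (hmain i (by omega)).2 _ ?_
    change (T ^ (m - i) * T ^ j) u = 0
    rw [← pow_add, show m - i + j = (j - i - 1) + (m + 1) by omega, pow_add, hnil, mul_zero]
    rfl
  intro i j hij
  rcases lt_or_gt_of_ne (Fin.val_ne_of_ne hij) with h | h
  · exact inner_eq_zero_symm.1 (hlt i j h (by omega))
  · exact hlt j i h (by omega)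

end Nilpotent

/-! ### Irreducible matrices: simple eigenvalues and the class `Sₙ` -/

section Matrices

variable {n : ℕ} {A B : Matrix (Fin n) (Fin n) ℂ}

theorem op_conjTranspose (A : Matrix (Fin n) (Fin n) ℂ) : op A.conjTranspose = adjoint (op A) :=
  map_star (Matrix.toEuclideanCLM (n := Fin n) (𝕜 := ℂ)) A

theorem rank_eq_finrank_range_op (A : Matrix (Fin n) (Fin n) ℂ) :
    A.rank = Module.finrank ℂ (LinearMap.range (op A).toLinearMap) := by
  rw [A.rank_eq_finrank_range_toLin (EuclideanSpace.basisFun (Fin n) ℂ).toBasis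
    (EuclideanSpace.basisFun (Fin n) ℂ).toBasis]
  rfl

theorem finrank_ker_op_eq_one (hrank : A.rank + 1 = n) :
    Module.finrank ℂ (LinearMap.ker (op A).toLinearMap) = 1 := by
  have h := (op A).toLinearMap.finrank_range_add_finrank_ker
  rw [← rank_eq_finrank_range_op, finrank_euclideanSpace_fin] at h
  omega

/-- A unimodular eigenvector of a contraction spans a reducing subspace. -/
theorem UnitarilyIrreducible.eq_zero_of_apply_eq_smul (hirr : UnitarilyIrreducible A)
    (hA : ∀ x, ‖op A x‖ ≤ ‖x‖) (hrank : A.rank + 1 = n) (μ : ℂ) (x : EuclideanSpace ℂ (Fin n))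
    (hμ : ‖μ‖ = 1) (hx : op A x = μ • x) : x = 0 := by
  have hadj := adjoint_apply_of_apply_eq_smul hA hμ hx
  have hspan : ∀ (S : EuclideanSpace ℂ (Fin n) →L[ℂ] EuclideanSpace ℂ (Fin n)) (ν : ℂ),
      S x = ν • x → ∀ y ∈ Submodule.span ℂ {x}, S y ∈ Submodule.span ℂ {x} := by
    intro S ν hS y hy
    obtain ⟨a, rfl⟩ := Submodule.mem_span_singleton.1 hy
    rw [map_smul, hS, smul_comm]
    exact Submodule.smul_mem _ _ hy
  rcases hirr _ (hspan _ _ hx) (by rw [op_conjTranspose]; exact hspan _ _ hadj) with h | h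
  · exact Submodule.span_singleton_eq_bot.1 h
  · -- `A` would be multiplication by `μ`, hence injective
    exfalso
    obtain ⟨v, hv, -⟩ := finrank_eq_one_iff'.1 (finrank_ker_op_eq_one hrank)
    have hvx : (v : EuclideanSpace ℂ (Fin n)) ∈ Submodule.span ℂ {x} := h ▸ Submodule.mem_top
    obtain ⟨a, ha⟩ := Submodule.mem_span_singleton.1 hvx
    have h1 : op A v = μ • (v : EuclideanSpace ℂ (Fin n)) := by
      rw [← ha, map_smul, hx, smul_comm]
    have h2 : op A v = 0 := v.2
    have hμ0 : μ ≠ 0 := norm_ne_zero_iff.1 (by rw [hμ]; exact one_ne_zero)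
    exact hv (Subtype.ext ((smul_eq_zero.1 (h1.symm.trans h2)).resolve_left hμ0))

theorem op_rePart_rotate (A : Matrix (Fin n) (Fin n) ℂ) (θ : ℝ) (x : EuclideanSpace ℂ (Fin n)) :
    (2 : ℂ) • op (rePart (rotate A θ)) x =
      Complex.exp (-(Complex.I * θ)) • op A x +
        starRingEnd ℂ (Complex.exp (-(Complex.I * θ))) • adjoint (op A) x := by
  rw [← op_conjTranspose]
  have h : op (rePart (rotate A θ)) = (2⁻¹ : ℂ) • (Complex.exp (-(Complex.I * θ)) • op A +
      starRingEnd ℂ (Complex.exp (-(Complex.I * θ))) • op A.conjTranspose) := by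
    simp only [op, rePart, rotate, Matrix.conjTranspose_smul, map_smul, map_add]
    rfl
  rw [h]
  rw [smul_apply, smul_smul, mul_inv_cancel₀ two_ne_zero, one_smul]
  rfl

theorem strictAnti_eigenvalues₀_of_simple {H : Matrix (Fin n) (Fin n) ℂ} (hH : H.IsHermitian)
    (hsimple : ∀ (l : ℝ) (x y : EuclideanSpace ℂ (Fin n)), op H x = (l : ℂ) • x →
      op H y = (l : ℂ) • y → ¬ LinearIndependent ℂ ![x, y]) : StrictAnti hH.eigenvalues₀ := by
  refine hH.eigenvalues₀_antitone.strictAnti_of_injective fun i j hij => ?_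
  by_contra hne
  have hsymm := Matrix.isSymmetric_toEuclideanLin_iff.mpr hH
  have happ := hsymm.apply_eigenvectorBasis finrank_euclideanSpace
  refine hsimple (hH.eigenvalues₀ i) _ _ (happ i) (by rw [hij]; exact happ j) ?_
  have hli := (hsymm.eigenvectorBasis finrank_euclideanSpace).orthonormal.linearIndependent
  have := hli.comp ![i, j] (by
    intro a b hab
    fin_cases a <;> fin_cases b <;> simp_all)
  have hcomp : ![hsymm.eigenvectorBasis finrank_euclideanSpace i,
      hsymm.eigenvectorBasis finrank_euclideanSpace j]
      = hsymm.eigenvectorBasis finrank_euclideanSpace ∘ ![i, j] := by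
    funext a
    fin_cases a <;> rfl
  rw [hcomp]
  exact this

/-- By irreducibility no eigenvalue of `A` is unimodular, so every `Re (e^{-iθ}A)` has simple
eigenvalues; both claims follow from this. -/
theorem nf_of_isPartialIsometry (hA : IsPartialIsometry A) (hrank : A.rank + 1 = n) : NF A := by
  intro hirr
  have hsimple := fun (c : ℂ) (l : ℝ) (x y : EuclideanSpace ℂ (Fin n)) (hc : ‖c‖ = 1) =>
    not_linearIndependent_of_realPart_eigenvectors hA (finrank_ker_op_eq_one hrank)
      (hirr.eq_zero_of_apply_eq_smul (norm_apply_le_of_norm_eq_on_ker_orthogonal hA) hrank)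
      hc (l := l) (x := x) (y := y)
  refine ⟨fun θ _ => ?_, containsNoSegment_frontier_of_simple hsimple⟩
  have hc : ‖Complex.exp (-(Complex.I * θ))‖ = 1 := by
    rw [Complex.norm_exp]
    simp
  refine strictAnti_eigenvalues₀_of_simple _ fun l x y hx hy => hsimple _ l x y hc ?_ ?_
  · rw [← op_rePart_rotate, hx, smul_smul]
  · rw [← op_rePart_rotate, hy, smul_smul]

theorem isClassS_of_unitarilyIrreducible (hA : IsPartialIsometry A) (hrank : A.rank + 1 = n)
    (hirr : UnitarilyIrreducible A) : IsClassS A := by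
  have hcontr := norm_apply_le_of_norm_eq_on_ker_orthogonal hA
  refine ⟨hcontr, fun μ hμ => ?_, ?_⟩
  · rw [← Matrix.spectrum_toLpLin 2, ← Module.End.hasEigenvalue_iff_mem_spectrum] at hμ
    obtain ⟨x, hx⟩ := hμ.exists_hasEigenvector
    have hx' : op A x = μ • x := hx.apply_eq_smul
    have h := hcontr x
    rw [hx', norm_smul] at h
    rw [mem_ball_zero_iff]
    refine lt_of_le_of_ne ?_ fun h1 =>
      hx.2 (hirr.eq_zero_of_apply_eq_smul hcontr hrank μ x h1 hx')
    exact le_of_mul_le_mul_right (by rwa [one_mul]) (norm_pos_iff.2 hx.2)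
  · have h : op (1 - A.conjTranspose * A) = 1 - adjoint (op A) * op A := by
      rw [← op_conjTranspose]
      simp only [op, map_sub, map_mul, map_one]
    rw [rank_eq_finrank_range_op, h, range_one_sub_adjoint_mul_self hA,
      finrank_ker_op_eq_one hrank]

/-! ### Unitary similarity and the Jordan block -/

theorem isNilpotent_jordanBlock (n : ℕ) : IsNilpotent (jordanBlock n) := by
  have htri : (jordanBlock n).IsUpperTriangular := by
    intro i j hij
    have hij' : (j : ℕ) < i := hij
    simp only [jordanBlock, Matrix.of_apply]
    exact if_neg (by omega)
  have h := (jordanBlock n).aeval_self_charpoly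
  rw [Matrix.charpoly_of_isUpperTriangular _ htri] at h
  refine ⟨n, ?_⟩
  simpa [jordanBlock] using h

theorem UnitarilySimilar.symm (h : UnitarilySimilar A B) : UnitarilySimilar B A := by
  obtain ⟨U, hU, rfl⟩ := h
  refine ⟨U.conjTranspose, Unitary.star_mem hU, ?_⟩
  have h1 : U.conjTranspose * U = 1 := Matrix.mem_unitaryGroup_iff'.1 hU
  rw [Matrix.conjTranspose_conjTranspose]
  calc B = (U.conjTranspose * U) * B * (U.conjTranspose * U) := by simp [h1]
    _ = _ := by simp only [Matrix.mul_assoc]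

theorem UnitarilySimilar.isNilpotent (h : UnitarilySimilar A B) (hB : IsNilpotent B) :
    IsNilpotent A := by
  obtain ⟨U, hU, rfl⟩ := h
  obtain ⟨k, hk⟩ := hB
  have h1 : U.conjTranspose * U = 1 := Matrix.mem_unitaryGroup_iff'.1 hU
  have hpow : ∀ k : ℕ, (U * B * U.conjTranspose) ^ (k + 1) = U * B ^ (k + 1) * U.conjTranspose := by
    intro k
    induction k with
    | zero => simp
    | succ k ih =>
      rw [pow_succ, ih]
      calc _ = U * B ^ (k + 1) * (U.conjTranspose * U) * B * U.conjTranspose := by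
            simp only [Matrix.mul_assoc]
        _ = _ := by rw [h1, pow_succ B (k + 1)]; simp only [Matrix.mul_assoc, Matrix.one_mul]
  exact ⟨k + 1, by rw [hpow, pow_succ, hk]; simp⟩

theorem norm_op_of_mem_unitaryGroup {U : Matrix (Fin n) (Fin n) ℂ}
    (hU : U ∈ Matrix.unitaryGroup (Fin n) ℂ) (x : EuclideanSpace ℂ (Fin n)) :
    ‖op U x‖ = ‖x‖ := by
  have h1 : U.conjTranspose * U = 1 := Matrix.mem_unitaryGroup_iff'.1 hU
  have h2 : adjoint (op U) (op U x) = x := by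
    rw [← op_conjTranspose]
    change (op U.conjTranspose * op U) x = x
    rw [← map_mul, h1, map_one]
    rfl
  have h3 : ⟪op U x, op U x⟫_ℂ = ⟪x, x⟫_ℂ := by
    rw [← ContinuousLinearMap.adjoint_inner_right, h2]
  rw [@norm_eq_sqrt_re_inner ℂ, @norm_eq_sqrt_re_inner ℂ _ _ _ _ x, h3]

theorem UnitarilySimilar.numericalRange_subset (h : UnitarilySimilar A B) :
    numericalRange A ⊆ numericalRange B := by
  obtain ⟨U, hU, rfl⟩ := h
  rintro _ ⟨x, hx, rfl⟩
  refine ⟨op U.conjTranspose x, ?_, ?_⟩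
  · rw [← Matrix.star_eq_conjTranspose, norm_op_of_mem_unitaryGroup (Unitary.star_mem hU), hx]
  · rw [op_conjTranspose, ContinuousLinearMap.adjoint_inner_left, ← op_conjTranspose]
    simp only [op, map_mul]
    rfl

theorem UnitarilySimilar.numericalRange_eq (h : UnitarilySimilar A B) :
    numericalRange A = numericalRange B :=
  h.numericalRange_subset.antisymm h.symm.numericalRange_subset

/-- Conjugation by the diagonal matrix with entries `cᵏ` rotates the Jordan block. -/
theorem unitarilySimilar_smul_jordanBlock (n : ℕ) {c : ℂ} (hc : ‖c‖ = 1) :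
    UnitarilySimilar (c • jordanBlock n) (jordanBlock n) := by
  have hc' : c * starRingEnd ℂ c = 1 := by rw [Complex.mul_conj', hc]; norm_num
  refine ⟨Matrix.diagonal fun k => starRingEnd ℂ c ^ (k : ℕ), ?_, ?_⟩
  · rw [Matrix.mem_unitaryGroup_iff, Matrix.star_eq_conjTranspose, Matrix.diagonal_conjTranspose,
      Matrix.diagonal_mul_diagonal, ← Matrix.diagonal_one]
    congr 1
    ext k
    simp [← mul_pow, mul_comm, hc']
  · ext i j
    rw [Matrix.diagonal_conjTranspose, Matrix.mul_diagonal, Matrix.diagonal_mul]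
    simp only [jordanBlock, Matrix.smul_apply, Matrix.of_apply, smul_eq_mul, Pi.star_apply,
      star_pow, RCLike.star_def, Complex.conj_conj]
    split_ifs with hij
    · rw [← hij, mul_one, mul_one, pow_succ, ← mul_assoc, ← mul_pow, mul_comm _ c, mul_comm _ c, hc',
        one_pow, mul_one]
    · simp

theorem mul_mem_numericalRange_jordanBlock {c : ℂ} (hc : ‖c‖ = 1) {z : ℂ}
    (hz : z ∈ numericalRange (jordanBlock n)) : c * z ∈ numericalRange (jordanBlock n) := by
  rw [← (unitarilySimilar_smul_jordanBlock n hc).numericalRange_eq]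
  obtain ⟨x, hx, rfl⟩ := hz
  refine ⟨x, hx, ?_⟩
  simp only [op, map_smul]
  change ⟪x, c • op (jordanBlock n) x⟫_ℂ = _
  rw [inner_smul_right]

theorem unitarilySimilar_jordanBlock_of_isNilpotent (hA : IsPartialIsometry A)
    (hrank : A.rank + 1 = n) (hnil : IsNilpotent A) : UnitarilySimilar A (jordanBlock n) := by
  obtain ⟨m, rfl⟩ : ∃ m, n = m + 1 := ⟨A.rank, hrank.symm⟩
  have hpow : A ^ (m + 1) = 0 := by
    have h := (Matrix.isNilpotent_charpoly_sub_pow_of_isNilpotent hnil).eq_zero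
    rw [sub_eq_zero, Fintype.card_fin] at h
    simpa [h] using A.aeval_self_charpoly
  obtain ⟨u, hu⟩ := exists_orthonormal_orbit hA (finrank_ker_op_eq_one hrank)
    (finrank_euclideanSpace_fin (n := m + 1)) (by simp only [op, ← map_pow, hpow, map_zero])
  -- reversed, the orbit `u, Au, …, Aᵐu` is a basis on which `A` acts as the Jordan block
  have hv := hu.comp Fin.rev Fin.rev_injective
  set v : Fin (m + 1) → EuclideanSpace ℂ (Fin (m + 1)) :=
    (fun j : Fin (m + 1) => (op A ^ (j : ℕ)) u) ∘ Fin.rev with hvdef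
  have hspan : Submodule.span ℂ (Set.range v) = ⊤ :=
    hv.linearIndependent.span_eq_top_of_card_eq_finrank (by simp)
  set b := OrthonormalBasis.mk hv hspan.ge
  have hb : ∀ j, b j = v j := fun j => by rw [OrthonormalBasis.coe_mk]
  set U := (EuclideanSpace.basisFun (Fin (m + 1)) ℂ).toBasis.toMatrix b.toBasis with hUdef
  have hU : U ∈ Matrix.unitaryGroup (Fin (m + 1)) ℂ :=
    (EuclideanSpace.basisFun (Fin (m + 1)) ℂ).toMatrix_orthonormalBasis_mem_unitary b
  have hUv : ∀ i j, U i j = v j i := fun i j => by rw [← hb]; rfl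
  have hAv0 : op A (v 0) = 0 := by
    change op A ((op A ^ (m + 1 - (0 + 1))) u) = 0
    change (op A * op A ^ (m + 1 - (0 + 1))) u = 0
    rw [← pow_succ', ← map_pow, show m + 1 - (0 + 1) + 1 = m + 1 by omega, hpow, map_zero]
    rfl
  have hAv : ∀ j : Fin m, op A (v j.succ) = v j.castSucc := by
    intro j
    change (op A * op A ^ (m + 1 - (j.succ + 1 : ℕ))) u = (op A ^ (m + 1 - (j.castSucc + 1 : ℕ))) u
    rw [← pow_succ']
    congr 2
    simp only [Fin.val_succ, Fin.val_castSucc]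
    omega
  have hAU : ∀ i j, (A * U) i j = op A (v j) i := by
    intro i j
    rw [Matrix.mul_apply]
    simp only [hUv]
    rfl
  have hcomm : A * U = U * jordanBlock (m + 1) := by
    ext i j
    rw [hAU, Matrix.mul_apply]
    simp only [jordanBlock, Matrix.of_apply, hUv]
    refine Fin.cases ?_ (fun j => ?_) j
    · rw [hAv0]
      simp
    · rw [hAv, Finset.sum_eq_single j.castSucc]
      · simp
      · intro k _ hk
        rw [if_neg, mul_zero]
        intro h
        exact hk (Fin.ext (by simpa using h))
      · simp
  refine ⟨U, hU, ?_⟩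
  have h1 : U * U.conjTranspose = 1 := Matrix.mem_unitaryGroup_iff.1 hU
  rw [← hcomm, Matrix.mul_assoc, h1, Matrix.mul_one]

/-- The numerical range of the Jordan block is convex, compact and invariant under rotations, hence a
disk. -/
theorem circ_of_isPartialIsometry (hA : IsPartialIsometry A) (hrank : A.rank + 1 = n) :
    Circ A := by
  intro hnil
  have hsim := unitarilySimilar_jordanBlock_of_isNilpotent hA hrank hnil
  have hne : (numericalRange A).Nonempty := by
    have : Nontrivial (EuclideanSpace ℂ (Fin n)) :=
      Module.nontrivial_of_finrank_pos (R := ℂ) (by rw [finrank_euclideanSpace_fin]; omega)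
    obtain ⟨x, hx⟩ := exists_norm_eq (EuclideanSpace ℂ (Fin n)) zero_le_one
    exact ⟨_, x, hx, rfl⟩
  obtain ⟨r, hr, h⟩ := eq_closedBall_of_convex_of_rotation
    (convex_setOf_inner_self_apply (op A)) (isCompact_setOf_inner_self_apply (op A)) hne
    fun c hc z hz => by
      change c * z ∈ numericalRange A
      rw [hsim.numericalRange_eq]
      exact mul_mem_numericalRange_jordanBlock hc (hsim.numericalRange_eq ▸ hz)
  refine ⟨r, hr, fun hn => hr.lt_of_ne fun hr0 => ?_, h⟩
  -- a complex operator whose quadratic form vanishes is zero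
  have hzero : ∀ x, ⟪op A x, x⟫_ℂ = 0 := by
    intro x
    by_cases hx : x = 0
    · rw [hx, inner_zero_right]
    have hn0 := norm_ne_zero_iff.2 hx
    have hmem : ⟪((‖x‖⁻¹ : ℝ) : ℂ) • x, op A (((‖x‖⁻¹ : ℝ) : ℂ) • x)⟫_ℂ ∈ numericalRange A :=
      ⟨_, by rw [norm_smul, Complex.norm_real, norm_inv, norm_norm, inv_mul_cancel₀ hn0], rfl⟩
    have h0 := h.subset hmem
    rw [← hr0, Metric.closedBall_zero, Set.mem_singleton_iff, map_smul, inner_smul_left,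
      inner_smul_right] at h0
    have hc : ((‖x‖⁻¹ : ℝ) : ℂ) ≠ 0 := by exact_mod_cast inv_ne_zero hn0
    have h1 : ⟪x, op A x⟫_ℂ = 0 := by simpa [hc, hx] using h0
    exact inner_eq_zero_symm.1 h1
  have hA0 := (inner_map_self_eq_zero (op A).toLinearMap).1 hzero
  rw [rank_eq_finrank_range_op, hA0, LinearMap.range_zero, finrank_bot] at hrank
  omega

end Matrices

end PartialIsometry

theorem mainTheorem5 (n : ℕ) (A : Matrix (Fin n) (Fin n) ℂ)
    (hA : PartialIsometry.IsPartialIsometry A) (hrank : A.rank + 1 = n) :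
    PartialIsometry.NF A ∧
    PartialIsometry.Circ A ∧
    (PartialIsometry.UnitarilyIrreducible A → PartialIsometry.IsClassS A) ∧
    (IsNilpotent A ↔ PartialIsometry.UnitarilySimilar A (PartialIsometry.jordanBlock n)) :=
  ⟨PartialIsometry.nf_of_isPartialIsometry hA hrank,
    PartialIsometry.circ_of_isPartialIsometry hA hrank,
    PartialIsometry.isClassS_of_unitarilyIrreducible hA hrank,
    PartialIsometry.unitarilySimilar_jordanBlock_of_isNilpotent hA hrank,
    fun h => h.isNilpotent (PartialIsometry.isNilpotent_jordanBlock n)⟩
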